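/- Let $\mathcal A_1,\mathcal A_2,\mathcal A_3$ be abelian categories such that $\mathcal A_1,\mathcal A_2$ have all limits and $\mathcal A_3$ has all colimits, and let \[ T:\mathcal A_1\times\mathcal A_2\to\mathcal A_3,\qquad H:\mathcal A_2^{op}\times\mathcal A_3\to\mathcal A_1,\qquad C:\mathcal A_1^{op}\times\mathcal A_3\to\mathcal A_2 \] be biadditive functors together with natural isomorphisms $\mathcal A_3(T(X_1,X_2),X_3)\cong\mathcal A_1(X_1,H(X_2,X_3))$ and $\mathcal A_3(T(X_1,X_2),X_3)\cong\mathcal A_2(X_2,C(X_1,X_3))$. For a class $\mathcal K$ of objects of an abelian category $\mathcal A$, let $\mathcal K^{\perp}$ be the class of objects $X$ such that $\mathcal A(B,X)\to\mathcal A(A,X)$ is surjective for every short exact sequence $0\to A\to B\to K\to 0$ with $K\in\mathcal K$, and let ${}^{\perp}\mathcal K$ be the class of objects $X$ such that $\mathcal A(X,A)\to\mathcal A(X,B)$ is surjective for every short exact sequence $0\to K\to A\to B\to 0$ with $K\in\mathcal K$. A pair $(\mathcal X,\mathcal Y)$ of classes is a cotorsion theory if $\mathcal X={}^{\perp}\mathcal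 Y$ and $\mathcal Y=\mathcal X^{\perp}$. Write $Ch(\mathcal A)$ for the category of ($\mathbb Z$-indexed) chain complexes in $\mathcal A$ and $Ch(\mathcal K)$ for the class of complexes $\mathbf C$ with $\mathbf C_n\in\mathcal K$ for all $n$. For complexes $\mathbf C,\mathbf D$ in $\mathcal A$ let $\mathrm{Homgr}(\mathbf C,\mathbf D)$ be the complex of abelian groups with $\mathrm{Homgr}(\mathbf C,\mathbf D)_n=\prod_p\mathcal A(\mathbf C_p,\mathbf D_{p+n})$ and differential $f\mapsto d_{\mathbf D}f-(-1)^nfd_{\mathbf C}$ in degree $n$. For a class $\mathfrak K$ of complexes, let $\mathfrak K^{\perp_h}$ (resp. ${}^{\perp_h}\mathfrak K$) be the class of complexes $\mathbf D$ such that $\mathrm{Homgr}(\mathbf C,\mathbf D)$ (resp. $\mathrm{Homgr}(\mathbf D,\mathbf C)$) has zero homology for all $\mathbf C\in\mathfrak K$. An object $P_1$ of $\mathcal A_1$ (resp. $P_2$ of $\mathcal A_2$) is flat if $T(P_1,-)$ (resp. $T(-,P_2)$) preserves monomorphisms. Let $\mathcal F$ be the class of flat objects of $\mathcal A_2$, and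 let $\underline{\mathcal F^{\perp}}$ be the class of objects $Y\in\mathcal F^{\perp}$ such that for every exact sequence $0\to Y\to A\to X$ with $X\in\mathcal F$ the monomorphism $Y\to A$ has a retraction. Let $tex(\mathcal F)$ be the class of complexes $\mathbf C\in Ch(\mathcal F)$ that are exact and such that the complex $T(S^0(E),\mathbf C)$ is exact for every injective object $E$ of $\mathcal A_1$; here $S^0(E)$ is $E$ concentrated in degree $0$, and for complexes $T(\mathbf C',\mathbf C)_n=\bigoplus_{p+q=n}T(\mathbf C'_p,\mathbf C_q)$ with differential $T(d',\mathbf C_q)+(-1)^pT(\mathbf C'_p,d)$ on the summand of index $(p,q)$. Suppose that (1) for $i=1,2$, every object of $\mathcal A_i$ is a quotient of a flat object of $\mathcal A_i$; (2) $\mathcal A_3$ has enough injective objects; (3) every object of $\mathcal A_2$ is a subobject of an object of $\underline{\mathcal F^{\perp}}$. Then $(tex(\mathcal F),tex(\mathcal F)^{\perp})$ is a cotorsion theory in $Ch(\mathcal A_2)$, and \[ tex(\mathcal F)=Ch(\mathcal F)\cap{}^{\perp_h}\bigl(tex(\mathcal F)^{\perp}\bigr) \quad\text{and}\quad tex(\mathcal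 F)^{\perp}=Ch(\mathcal F^{\perp})\cap tex(\mathcal F)^{\perp_h}. \] -/

import Mathlib

open CategoryTheory CategoryTheory.Limits

universe v u v₁ v₂ v₃ u₁ u₂ u₃

/-! ### Orthogonal classes and cotorsion theories -/

namespace CotorsionTHC

section Abelian

variable {A : Type u} [Category.{v} A] [Abelian A]

/-- The class `K^⊥` of the objects `X` such that `Hom(-, X) : Aᵒᵖ ⥤ Ab` preserves epimorphisms of
`Aᵒᵖ` with kernel in `K`: for every short exact sequence `A' ↣ A ↠ A''` with `A''` in `K`, the
map `Hom(A, X) → Hom(A', X)` is surjective. -/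
def rightPerp (K : ObjectProperty A) : ObjectProperty A := fun X =>
  ∀ S : ShortComplex A, S.ShortExact → K S.X₃ →
    Function.Surjective (fun g : S.X₂ ⟶ X => S.f ≫ g)

/-- The class `^⊥K` of the objects `X` such that `Hom(X, -) : A ⥤ Ab` preserves epimorphisms with
kernel in `K`. -/
def leftPerp (K : ObjectProperty A) : ObjectProperty A := fun X =>
  ∀ S : ShortComplex A, S.ShortExact → K S.X₁ →
    Function.Surjective (fun g : X ⟶ S.X₂ => g ≫ S.g)

/-- A cotorsion theory: `𝒳 = ^⊥𝒴` and `𝒴 = 𝒳^⊥`. -/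
def IsCotorsionTheory (𝒳 𝒴 : ObjectProperty A) : Prop :=
  𝒳 = leftPerp 𝒴 ∧ 𝒴 = rightPerp 𝒳

/-- The subclass of `𝒴` (written `𝒴` underlined) of the objects `Y` in `𝒴` such that for every
exact sequence `0 → Y → A → X` with `X` in `𝒳` the monomorphism `Y → A` has a retraction. -/
def underlineRight (𝒳 𝒴 : ObjectProperty A) : ObjectProperty A := fun Y =>
  𝒴 Y ∧ ∀ ⦃B X : A⦄ (i : Y ⟶ B) (p : B ⟶ X) (w : i ≫ p = 0),
    Mono i → (ShortComplex.mk i p w).Exact → 𝒳 X → ∃ r : B ⟶ Y, i ≫ r = 𝟙 Y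

/-- The class `Ch(K)` of the chain complexes that are degreewise in `K`. -/
def degreewise (K : ObjectProperty A) : ObjectProperty (ChainComplex A ℤ) := fun C =>
  ∀ n : ℤ, K (C.X n)

/-- The class `ex(K)` of the exact chain complexes that are degreewise in `K`. -/
def exactDegreewise (K : ObjectProperty A) : ObjectProperty (ChainComplex A ℤ) := fun C =>
  C.Acyclic ∧ degreewise K C

end Abelian

/-! ### The complex `Homgr` and homotopy orthogonality -/

section Homgr

variable {A : Type u} [Category.{v} A] [Preadditive A]

/-- The group `∏ₚ Hom(C_p, D_{p+n})` of morphisms of degree `n` from `C` to `D`. The factors are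
indexed by the pairs `(p, q)` with `p + n = q`. -/
abbrev GradedHom (C D : ChainComplex A ℤ) (n : ℤ) : Type v :=
  ∀ t : {t : ℤ × ℤ // t.1 + n = t.2}, C.X t.1.1 ⟶ D.X t.1.2

/-- The component `C_p ⟶ D_q` of a morphism of degree `n = q - p`. -/
abbrev GradedHom.comp {C D : ChainComplex A ℤ} {n : ℤ} (f : GradedHom C D n) (p q : ℤ)
    (h : p + n = q) : C.X p ⟶ D.X q :=
  f ⟨(p, q), h⟩

/-- The differential `f ↦ d f - (-1)ⁿ f d` from degree `n` to degree `m = n - 1`. -/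
def gradedHomD (C D : ChainComplex A ℤ) (n m : ℤ) (h : m + 1 = n) :
    GradedHom C D n →+ GradedHom C D m where
  toFun f := fun t =>
    f.comp t.1.1 (t.1.2 + 1) (by have := t.2; omega) ≫ D.d (t.1.2 + 1) t.1.2 -
      n.negOnePow • (C.d t.1.1 (t.1.1 - 1) ≫
        f.comp (t.1.1 - 1) t.1.2 (by have := t.2; omega))
  map_zero' := by
    funext t
    simp [GradedHom.comp]
  map_add' f g := by
    funext t
    simp only [GradedHom.comp, Pi.add_apply, Preadditive.add_comp, Preadditive.comp_add, smul_add]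
    abel

theorem gradedHomD_comp (C D : ChainComplex A ℤ) (n m l : ℤ) (h : m + 1 = n) (h' : l + 1 = m)
    (f : GradedHom C D n) : gradedHomD C D m l h' (gradedHomD C D n m h f) = 0 := by
  subst h' h
  funext ⟨⟨p, q⟩, ht⟩
  simp [gradedHomD, GradedHom.comp, Int.negOnePow_succ]

/-- The chain complex of abelian groups `Homgr(C, D)`. -/
noncomputable def Homgr (C D : ChainComplex A ℤ) : ChainComplex AddCommGrpCat.{v} ℤ where
  X n := AddCommGrpCat.of (GradedHom C D n)
  d n m := if h : m + 1 = n then AddCommGrpCat.ofHom (gradedHomD C D n m h) else 0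
  shape n m h := dif_neg h
  d_comp_d' n m l h h' := by
    have e : m + 1 = n := h
    have e' : l + 1 = m := h'
    rw [dif_pos e, dif_pos e']
    ext f
    exact congrFun (gradedHomD_comp C D n m l e e' f) _

/-- `𝔎^{⊥_h}`: the complexes `D` such that `Homgr(C, D)` has zero homology for all `C` in `𝔎`. -/
def rightHPerp (𝔎 : ObjectProperty (ChainComplex A ℤ)) : ObjectProperty (ChainComplex A ℤ) :=
  fun D => ∀ C, 𝔎 C → (Homgr C D).Acyclic

/-- `^{⊥_h}𝔎`: the complexes `D` such that `Homgr(D, C)` has zero homology for all `C` in `𝔎`. -/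
def leftHPerp (𝔎 : ObjectProperty (ChainComplex A ℤ)) : ObjectProperty (ChainComplex A ℤ) :=
  fun D => ∀ C, 𝔎 C → (Homgr D C).Acyclic

end Homgr

/-! ### The tensor product of complexes, flat objects and totally acyclic complexes -/

/-- The Koszul signs `(-1)ᵖ` for chain complexes indexed by `ℤ`: the total differential is
`d ⊗ 1 + (-1)ᵖ 1 ⊗ d` on the summand of bidegree `(p, q)`. -/
instance tensorSignsDownInt : (ComplexShape.down ℤ).TensorSigns where
  ε' := MonoidHom.mk' (fun p : Multiplicative ℤ => Int.negOnePow p.toAdd)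
    (fun p q => Int.negOnePow_add p.toAdd q.toAdd)
  rel_add p q r (h : q + 1 = p) := by
    change q + r + 1 = p + r
    omega
  add_rel p q r (h : q + 1 = p) := by
    change r + q + 1 = r + p
    omega
  ε'_succ p q (h : q + 1 = p) := by
    subst h
    change Int.negOnePow q = - Int.negOnePow (q + 1)
    rw [Int.negOnePow_succ, neg_neg]

section THC

variable {A₁ : Type u₁} {A₂ : Type u₂} {A₃ : Type u₃}
  [Category.{v₁} A₁] [Category.{v₂} A₂] [Category.{v₃} A₃]

/-- An object `P` of the first category is flat if `T(P, -)` preserves monomorphisms. -/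
def flatLeft (T : A₁ ⥤ A₂ ⥤ A₃) : ObjectProperty A₁ := fun P =>
  (T.obj P).PreservesMonomorphisms

/-- An object `P` of the second category is flat if `T(-, P)` preserves monomorphisms. -/
def flatRight (T : A₁ ⥤ A₂ ⥤ A₃) : ObjectProperty A₂ := fun P =>
  (T.flip.obj P).PreservesMonomorphisms

/-- The category `A` has enough objects in `K` (on the left): each object is a quotient of an
object in `K`. -/
def EnoughLeft {A : Type u} [Category.{v} A] (K : ObjectProperty A) : Prop :=
  ∀ X : A, ∃ (P : A) (p : P ⟶ X), K P ∧ Epi p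

/-- The category `A` has enough objects in `K` (on the right): each object is a subobject of an
object in `K`. -/
def EnoughRight {A : Type u} [Category.{v} A] (K : ObjectProperty A) : Prop :=
  ∀ X : A, ∃ (Y : A) (i : X ⟶ Y), K Y ∧ Mono i

variable [Abelian A₁] [Abelian A₂] [Abelian A₃] [HasColimits A₃]

/-- The tensor product of complexes induced by a biadditive bifunctor `T`: in degree `n` it is
`⨁_{p+q=n} T(C'_p, C_q)`, with differential `T(d', C_q) + (-1)ᵖ T(C'_p, d)`. -/
noncomputable abbrev tensorComplex (T : A₁ ⥤ A₂ ⥤ A₃)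
    [T.Additive] [∀ X : A₁, (T.obj X).Additive]
    (C' : ChainComplex A₁ ℤ) (C : ChainComplex A₂ ℤ) : ChainComplex A₃ ℤ :=
  HomologicalComplex.mapBifunctor C' C T (ComplexShape.down ℤ)

/-- The class `tex(ℱ)` of the `F`-totally acyclic complexes: the exact degreewise flat complexes
`C` such that `T(S⁰(E), C)` is exact for every injective object `E` of the first category. -/
def tex (T : A₁ ⥤ A₂ ⥤ A₃) [T.Additive] [∀ X : A₁, (T.obj X).Additive] :
    ObjectProperty (ChainComplex A₂ ℤ) := fun C =>
  (∀ E : A₁, Injective E →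
    (tensorComplex T ((HomologicalComplex.single A₁ (ComplexShape.down ℤ) 0).obj E) C).Acyclic) ∧
  exactDegreewise (flatRight T) C

end THC

end CotorsionTHC

/-! Membership of a complex K in `tex T` is a condition on Hom complexes: K is degreewise flat and
Hom(K, Y) is exact for every Y in a class 𝒴₀ ⊆ ℱ^⊥. This class consists of the objects of the
underlined ℱ^⊥, which detect exactness of K, and of the objects C(E, I) with E and I injective:
T(S⁰(E), K) is exact iff Hom(T(E, K), I) ≅ Hom(K, C(E, I)) is exact for all injective I (`tex_iff`).

For any such class t of complexes the conclusion is formal once ^⊥(F^⊥) ≤ F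
(`isCotorsionTheory_of_cohoExact`). The discs on objects of F^⊥ and the stalks on objects of 𝒴₀ lie
in t^⊥, and lifting against them forces a complex of ^⊥(t^⊥) into t. Cycles of Homgr(K, D) classify
degreewise split extensions of shifts of K by D, which links t^⊥ with homotopy orthogonality.

For flat objects, ^⊥(ℱ^⊥) ≤ ℱ follows because, for I injective, C(-, I) is exact with values in ℱ^⊥;
lifting against C(Z', I) → C(Z, I) makes T(Z, X) → T(Z', X) a monomorphism. -/

namespace CotorsionTHC

/-! ### Orthogonal classes in an abelian category -/

section Perp

variable {A : Type u} [Category.{v} A] [Abelian A]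

/-- Pulled back along f, the given sequence becomes an extension of X by `S.X₁`. It splits because
the identity of `S.X₁` extends along `i`, and a section yields the lift of f. -/
theorem le_leftPerp_rightPerp (K : ObjectProperty A) : K ≤ leftPerp (rightPerp K) := by
  intro X hX S hS hY f
  have := hS.mono_f
  have := hS.epi_g
  let i : S.X₁ ⟶ pullback S.g f := pullback.lift S.f 0 (by simp)
  have hi : i ≫ pullback.fst S.g f = S.f := pullback.lift_fst _ _ _
  have hi' : i ≫ pullback.snd S.g f = 0 := pullback.lift_snd _ _ _
  have : Mono i := mono_of_mono_fac hi
  let P : ShortComplex A := ShortComplex.mk i (pullback.snd S.g f) hi'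
  have hP : P.ShortExact := by
    refine { exact := P.exact_of_f_is_kernel (KernelFork.IsLimit.ofι' _ _ fun {W} k hk => ?_)
             mono_f := inferInstanceAs (Mono i)
             epi_g := inferInstanceAs (Epi (pullback.snd S.g f)) }
    have hk0 : k ≫ pullback.snd S.g f = 0 := hk
    have hk' : (k ≫ pullback.fst S.g f) ≫ S.g = 0 := by
      rw [Category.assoc, pullback.condition, reassoc_of% hk0, zero_comp]
    refine ⟨hS.exact.lift _ hk', ?_⟩
    apply pullback.hom_ext
    · change (_ ≫ i) ≫ _ = _
      rw [Category.assoc, hi, hS.exact.lift_f]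
    · change (_ ≫ i) ≫ _ = _
      rw [Category.assoc, hi', comp_zero, hk0]
  obtain ⟨r, hr⟩ := hY P hP hX (𝟙 _)
  have hr' : i ≫ r = 𝟙 _ := hr
  have := hP.epi_g
  -- The idempotent complementary to the retraction kills `i`, so it descends to a section of the
  -- projection.
  have hσ0 : P.f ≫ (𝟙 P.X₂ - r ≫ i) = 0 := by
    rw [Preadditive.comp_sub, Category.comp_id]
    change i - i ≫ r ≫ i = 0
    rw [reassoc_of% hr', sub_self]
  have hσ := hP.exact.g_desc _ hσ0
  set σ := hP.exact.desc _ hσ0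
  have hσ' : σ ≫ pullback.snd S.g f = 𝟙 X := by
    change σ ≫ P.g = 𝟙 _
    rw [← cancel_epi P.g, reassoc_of% hσ, Preadditive.sub_comp, Category.id_comp, Category.assoc]
    change P.g - r ≫ P.f ≫ P.g = _
    rw [P.zero, comp_zero, sub_zero]
    exact (Category.comp_id _).symm
  refine ⟨σ ≫ pullback.fst S.g f, ?_⟩
  change (σ ≫ _) ≫ S.g = f
  rw [Category.assoc, pullback.condition, reassoc_of% hσ', Category.id_comp]

theorem rightPerp_of_isZero (K : ObjectProperty A) {X : A} (h : IsZero X) : rightPerp K X :=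
  fun _ _ _ _ => ⟨0, h.eq_of_tgt _ _⟩

theorem leftPerp_of_isZero (K : ObjectProperty A) {X : A} (h : IsZero X) : leftPerp K X :=
  fun _ _ _ _ => ⟨0, h.eq_of_src _ _⟩

theorem rightPerp_of_iso (K : ObjectProperty A) {X Y : A} (e : X ≅ Y) (h : rightPerp K X) :
    rightPerp K Y := by
  intro S hS hK g
  obtain ⟨l, hl⟩ := h S hS hK (g ≫ e.inv)
  refine ⟨l ≫ e.hom, ?_⟩
  dsimp at hl ⊢
  rw [reassoc_of% hl, e.inv_hom_id, Category.comp_id]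

theorem leftPerp_of_iso (K : ObjectProperty A) {X Y : A} (e : X ≅ Y) (h : leftPerp K X) :
    leftPerp K Y := by
  intro S hS hK g
  obtain ⟨l, hl⟩ := h S hS hK (e.hom ≫ g)
  refine ⟨e.inv ≫ l, ?_⟩
  dsimp at hl ⊢
  rw [Category.assoc, hl, e.inv_hom_id_assoc]

end Perp

/-! ### Cycles and boundaries of Homgr -/

section Homgr

variable {A : Type u} [Category.{v} A] [Preadditive A]

theorem homgr_acyclic_iff (C D : ChainComplex A ℤ) :
    (Homgr C D).Acyclic ↔ ∀ (n : ℤ) (f : GradedHom C D n),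
      gradedHomD C D n (n - 1) (by omega) f = 0 →
        ∃ s : GradedHom C D (n + 1), gradedHomD C D (n + 1) n rfl s = f := by
  have key : ∀ n : ℤ, (Homgr C D).ExactAt n ↔ ∀ (f : GradedHom C D n),
      gradedHomD C D n (n - 1) (by omega) f = 0 →
        ∃ s : GradedHom C D (n + 1), gradedHomD C D (n + 1) n rfl s = f := by
    intro n
    rw [HomologicalComplex.exactAt_iff' _ (n + 1) n (n - 1) (by simp) (by simp),
      ShortComplex.ab_exact_iff]
    have e₁ : (Homgr C D).d (n + 1) n = AddCommGrpCat.ofHom (gradedHomD C D (n + 1) n rfl) :=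
      dif_pos rfl
    have e₂ : (Homgr C D).d n (n - 1) =
        AddCommGrpCat.ofHom (gradedHomD C D n (n - 1) (by omega)) := dif_pos (by omega)
    dsimp only [HomologicalComplex.shortComplexFunctor', HomologicalComplex.sc']
    rw [e₁, e₂]
    rfl
  exact ⟨fun h n => (key n).1 (h n), fun h n => (key n).2 (h n)⟩

/-- Reconciles indices such as p + 1 - 1 and p, which are equal but not definitionally so. -/
theorem GradedHom.eqToHom_comp {C D : ChainComplex A ℤ} {n p p' q : ℤ} (f : GradedHom C D n)
    (e : p = p') (h : p' + n = q) :
    (C.XIsoOfEq e).hom ≫ f.comp p' q h = f.comp p q (by omega) := by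
  subst e
  simp

end Homgr

/-! ### Exactness of Hom(K, Y) -/

section CohoExact

variable {A : Type u} [Category.{v} A] [Preadditive A]

/-- The complex `Hom(K, Y)` is exact: every map `K_n ⟶ Y` vanishing on boundaries extends along
the differential. -/
def CohoExact (K : ChainComplex A ℤ) (Y : A) : Prop :=
  ∀ (n : ℤ) (f : K.X n ⟶ Y), K.d (n + 1) n ≫ f = 0 → ∃ g : K.X (n - 1) ⟶ Y, K.d n (n - 1) ≫ g = f

theorem CohoExact.exists_fac {K : ChainComplex A ℤ} {Y : A} (hK : CohoExact K Y) {i j k : ℤ}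
    (hij : j + 1 = i) (hjk : k + 1 = j) (f : K.X j ⟶ Y) (hf : K.d i j ≫ f = 0) :
    ∃ g : K.X k ⟶ Y, K.d j k ≫ g = f := by
  subst hij
  obtain rfl : k = j - 1 := by omega
  exact hK j f hf

theorem cohoExact_of_isZero (K : ChainComplex A ℤ) {Y : A} (h : IsZero Y) : CohoExact K Y :=
  fun _ _ _ => ⟨0, h.eq_of_tgt _ _⟩

theorem CohoExact.of_iso {K : ChainComplex A ℤ} {Y Z : A} (e : Y ≅ Z) (h : CohoExact K Y) :
    CohoExact K Z := by
  intro n f hf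
  obtain ⟨g, hg⟩ := h n (f ≫ e.inv) (by rw [reassoc_of% hf, zero_comp])
  exact ⟨g ≫ e.hom, by rw [reassoc_of% hg, e.inv_hom_id, Category.comp_id]⟩

/-- When D has zero differential, Homgr(K, D) is, up to signs, a product of shifted complexes Hom(K,
D_q). -/
theorem homgr_acyclic_of_cohoExact {K D : ChainComplex A ℤ} (hd : ∀ i j, D.d i j = 0)
    (h : ∀ q, CohoExact K (D.X q)) : (Homgr K D).Acyclic := by
  rw [homgr_acyclic_iff]
  intro n f hf
  have key : ∀ t : {t : ℤ × ℤ // t.1 + (n + 1) = t.2}, ∃ g : K.X t.1.1 ⟶ D.X t.1.2,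
      ∀ (p : ℤ) (hp : t.1.1 + 1 = p),
        K.d p t.1.1 ≫ g = f.comp p t.1.2 (by have := t.2; omega) := by
    rintro ⟨⟨p, q⟩, ht⟩
    dsimp only at ht ⊢
    obtain ⟨g, hg⟩ := (h q).exists_fac (i := p + 1 + 1) (j := p + 1) (k := p) rfl rfl
      (f.comp (p + 1) q (by omega)) (by
        have h₁ := congrFun hf ⟨(p + 1 + 1, q), by dsimp only; omega⟩
        simp only [gradedHomD, AddMonoidHom.coe_mk, ZeroHom.coe_mk, hd, comp_zero, zero_sub,
          Pi.zero_apply, neg_eq_zero] at h₁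
        rw [smul_eq_zero_iff_eq] at h₁
        have e : p + 1 + 1 - 1 = p + 1 := by omega
        rw [← f.eqToHom_comp e, ← Category.assoc] at h₁
        simpa using h₁)
    refine ⟨g, ?_⟩
    rintro _ rfl
    exact hg
  choose s hs using key
  -- In degree n + 1 the differential is s ↦ -(-1)ⁿ⁺¹ s d = (-1)ⁿ s d; the factor (-1)ⁿ cancels this
  -- sign.
  refine ⟨fun t => n.negOnePow • s t, ?_⟩
  funext ⟨⟨p, q⟩, ht⟩
  dsimp only at ht
  have := hs ⟨(p - 1, q), by dsimp only; omega⟩ p (by dsimp only; omega)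
  simp only [gradedHomD, AddMonoidHom.coe_mk, ZeroHom.coe_mk, hd, comp_zero, zero_sub,
    GradedHom.comp, Int.negOnePow_succ] at this ⊢
  rw [Linear.comp_units_smul, this, Units.neg_smul, neg_neg, smul_smul,
    Int.units_mul_self, one_smul]

end CohoExact

/-! ### Shifts and degreewise split extensions -/

section Twist

variable {A : Type u} [Category.{v} A] [Preadditive A]

/-- The shift of a complex by `m`, with differential multiplied by the sign `(-1)ᵐ`. -/
abbrev twist (K : ChainComplex A ℤ) (m : ℤ) : ChainComplex A ℤ where
  X q := K.X (q - m)
  d i j := m.negOnePow • K.d (i - m) (j - m)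
  shape i j h := by
    have h' : ¬ j + 1 = i := h
    rw [K.shape _ _ (fun (h'' : j - m + 1 = i - m) => h' (by omega)), smul_zero]
  d_comp_d' i j k _ _ := by
    rw [Linear.units_smul_comp, Linear.comp_units_smul, K.d_comp_d, smul_zero, smul_zero]

theorem CohoExact.twist {K : ChainComplex A ℤ} {Y : A} (h : CohoExact K Y) (m : ℤ) :
    CohoExact (twist K m) Y := by
  intro n (f : K.X (n - m) ⟶ Y) hf
  have hf' : m.negOnePow • (K.d (n + 1 - m) (n - m) ≫ f) = 0 := by
    rw [← Linear.units_smul_comp]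
    exact hf
  rw [smul_eq_zero_iff_eq] at hf'
  obtain ⟨g, hg⟩ := h.exists_fac (k := n - 1 - m) (by omega) (by omega) f hf'
  refine ⟨m.negOnePow • g, ?_⟩
  change (m.negOnePow • K.d (n - m) (n - 1 - m)) ≫ _ = _
  rw [Linear.units_smul_comp, Linear.comp_units_smul, smul_smul, Int.units_mul_self, one_smul, hg]

variable [HasBinaryBiproducts A]

/-- The extension of `L` by `D` with connecting maps `φ i j : L_i ⟶ D_j`. -/
noncomputable abbrev twistedSum (D L : ChainComplex A ℤ) (φ : ∀ i j, L.X i ⟶ D.X j)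
    (hφ : ∀ i j, j + 1 ≠ i → φ i j = 0)
    (hφ' : ∀ i j k, j + 1 = i → k + 1 = j → φ i j ≫ D.d j k + L.d i j ≫ φ j k = 0) :
    ChainComplex A ℤ where
  X q := D.X q ⊞ L.X q
  d i j := biprod.desc (D.d i j ≫ biprod.inl) (L.d i j ≫ biprod.inr + φ i j ≫ biprod.inl)
  shape i j h := by
    rw [D.shape i j h, L.shape i j h, hφ i j h]
    ext <;> simp
  d_comp_d' i j k hij hjk := by
    have := hφ' i j k hij hjk
    apply biprod.hom_ext'
    · simp
    · apply biprod.hom_ext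
      · simpa [add_comm] using this
      · simp

end Twist

/-! ### Orthogonality versus homotopy orthogonality -/

section Cone

variable {A : Type u} [Category.{v} A] [Abelian A]

/-- A cycle of degree n is the connecting map of a degreewise split extension of `twist K (n + 1)`
by D. A retraction onto D exists by orthogonality, and its component on the shift of K bounds the
cycle. -/
theorem homgr_acyclic_of_rightPerp {t : ObjectProperty (ChainComplex A ℤ)}
    {K D : ChainComplex A ℤ} (hD : rightPerp t D) (hK : ∀ m, t (twist K m)) :
    (Homgr K D).Acyclic := by
  rw [homgr_acyclic_iff]
  intro n f hf
  have e₀ : ∀ {i j : ℤ}, j + 1 = i → i - (n + 1) + n = j := by omega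
  let φ : ∀ i j, (twist K (n + 1)).X i ⟶ D.X j := fun i j =>
    if h : j + 1 = i then f.comp (i - (n + 1)) j (e₀ h) else 0
  have hφ₁ : ∀ i j (h : j + 1 = i), φ i j = f.comp (i - (n + 1)) j (e₀ h) :=
    fun i j h => dif_pos h
  have hφ : ∀ i j, j + 1 ≠ i → φ i j = 0 := fun i j h => dif_neg h
  -- This is d² = 0 for the extension; the sign (-1)ⁿ⁺¹ of the twist makes it the cycle condition on
  -- f.
  have hφ' : ∀ i j k, j + 1 = i → k + 1 = j →
      φ i j ≫ D.d j k + (twist K (n + 1)).d i j ≫ φ j k = 0 := by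
    intro i j k hij hjk
    rw [hφ₁ i j hij, hφ₁ j k hjk]
    subst hij hjk
    have := congrFun hf ⟨(k + 1 + 1 - (n + 1), k), by dsimp only; omega⟩
    simp only [gradedHomD, AddMonoidHom.coe_mk, ZeroHom.coe_mk, Pi.zero_apply] at this
    have e : k + 1 + 1 - (n + 1) - 1 = k + 1 - (n + 1) := by omega
    have h' := f.eqToHom_comp (q := k) e (by omega)
    rw [← h', ← Category.assoc, K.d_comp_XIsoOfEq_hom, sub_eq_zero] at this
    change _ + ((n + 1).negOnePow • K.d _ _) ≫ _ = 0
    rw [Linear.units_smul_comp, Int.negOnePow_succ, Units.neg_smul, this]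
    exact add_neg_cancel _
  let B := twistedSum D (twist K (n + 1)) φ hφ hφ'
  let S : ShortComplex (ChainComplex A ℤ) :=
    { X₁ := D
      X₂ := B
      X₃ := twist K (n + 1)
      f := { f := fun q => biprod.inl }
      g := { f := fun q => biprod.snd
             comm' := fun i j _ => by apply biprod.hom_ext' <;> simp [B] }
      zero := by ext q; simp }
  have hS : S.ShortExact := by
    apply HomologicalComplex.shortExact_of_degreewise_shortExact
    intro q
    exact (ShortComplex.Splitting.ofHasBinaryBiproduct (D.X q)
      ((twist K (n + 1)).X q)).shortExact
  obtain ⟨r, hr⟩ := hD S hS (hK _) (𝟙 D)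
  have hr' : ∀ q, biprod.inl ≫ r.f q = 𝟙 (D.X q) := fun q =>
    congrArg (fun (g : D ⟶ D) => g.f q) hr
  have hcomm : ∀ i j (h : j + 1 = i), (biprod.inr ≫ r.f i) ≫ D.d i j =
      (twist K (n + 1)).d i j ≫ biprod.inr ≫ r.f j + f.comp (i - (n + 1)) j (e₀ h) := by
    intro i j h
    rw [Category.assoc, r.comm i j]
    simp [S, B, hr', hφ₁ i j h]
  refine ⟨fun t => (K.XIsoOfEq (by have := t.2; omega)).hom ≫
    (biprod.inr : (twist K (n + 1)).X t.1.2 ⟶ D.X t.1.2 ⊞ (twist K (n + 1)).X t.1.2) ≫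
      r.f t.1.2, ?_⟩
  funext ⟨⟨p, q⟩, ht⟩
  dsimp only at ht
  obtain rfl : p = q + 1 - (n + 1) := by omega
  have := hcomm (q + 1) q rfl
  rw [Category.assoc] at this
  simp only [gradedHomD, AddMonoidHom.coe_mk, ZeroHom.coe_mk, GradedHom.comp, Category.assoc,
    HomologicalComplex.XIsoOfEq_rfl, Iso.refl_hom, Category.id_comp,
    HomologicalComplex.d_comp_XIsoOfEq_hom_assoc, this]
  rw [Linear.units_smul_comp]
  exact add_sub_cancel_left _ _

/-- Extend f degreewise to maps g. Their failure to commute with the differentials vanishes on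
`S.X₁`, so it descends to a cycle h of degree -1 in Homgr(`S.X₃`, D). If s bounds h, then g minus
the pullback of s is a chain map that still extends f. -/
theorem rightPerp_of_degreewise_of_rightHPerp {F : ObjectProperty A}
    {t : ObjectProperty (ChainComplex A ℤ)} (ht : t ≤ degreewise F) {D : ChainComplex A ℤ}
    (hD : degreewise (rightPerp F) D) (hD' : rightHPerp t D) : rightPerp t D := by
  intro S hS hK f
  have hS' := (HomologicalComplex.shortExact_iff_degreewise_shortExact S).1 hS
  have hg : ∀ q, ∃ g : S.X₂.X q ⟶ D.X q, S.f.f q ≫ g = f.f q := fun q =>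
    hD q _ (hS' q) (ht _ hK q) (f.f q)
  choose g hg using hg
  have : ∀ q, Epi (S.g.f q) := fun q => (hS' q).epi_g
  have hdesc : ∀ p q, ∃ h : S.X₃.X p ⟶ D.X q,
      S.g.f p ≫ h = g p ≫ D.d p q - S.X₂.d p q ≫ g q := fun p q => by
    have h0 : S.f.f p ≫ (g p ≫ D.d p q - S.X₂.d p q ≫ g q) = 0 := by
      rw [Preadditive.comp_sub, reassoc_of% hg, S.f.comm_assoc, hg, f.comm, sub_self]
    have := (hS' p).epi_g
    exact ⟨(hS' p).exact.desc _ h0, (hS' p).exact.g_desc _ h0⟩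
  choose h hh using hdesc
  obtain ⟨s, hs⟩ := (homgr_acyclic_iff _ _).1 (hD' _ hK) (-1) (fun t => h t.1.1 t.1.2) (by
    funext ⟨⟨p, q⟩, hpq⟩
    simp only [gradedHomD, AddMonoidHom.coe_mk, ZeroHom.coe_mk, GradedHom.comp, Pi.zero_apply]
    rw [← cancel_epi (S.g.f p), Preadditive.comp_sub, Linear.comp_units_smul, reassoc_of% hh,
      S.g.comm_assoc, hh, comp_zero]
    have e : ∀ j, j = p - 1 → S.X₂.d p j ≫ g j ≫ D.d j q =
        S.X₂.d p (p - 1) ≫ g (p - 1) ≫ D.d (p - 1) q := by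
      rintro _ rfl
      rfl
    simp [Preadditive.sub_comp, Preadditive.comp_sub, e (q + 1) (by dsimp only at hpq; omega)])
  have hs' : ∀ p q, q + 1 = p →
      s.comp p p (by omega) ≫ D.d p q - S.X₃.d p q ≫ s.comp q q (by omega) = h p q := by
    rintro p q rfl
    have := congrFun hs ⟨(q + 1, q), by dsimp only; omega⟩
    simp only [gradedHomD, AddMonoidHom.coe_mk, ZeroHom.coe_mk] at this
    rw [← s.eqToHom_comp (p := q + 1 - 1) (p' := q) (q := q) (by omega) (by omega),
      ← Category.assoc, S.X₃.d_comp_XIsoOfEq_hom] at this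
    simpa using this
  refine ⟨{ f := fun q => g q - S.g.f q ≫ s.comp q q (by omega), comm' := ?_ }, ?_⟩
  · intro i j hij
    have h₁ := hh i j
    rw [← hs' i j hij, Preadditive.comp_sub] at h₁
    rw [Preadditive.sub_comp, Preadditive.comp_sub, Category.assoc, ← S.g.comm_assoc,
      sub_eq_sub_iff_sub_eq_sub, ← h₁]
  · ext q
    have : S.f.f q ≫ S.g.f q = 0 := by
      rw [← HomologicalComplex.comp_f, S.zero, HomologicalComplex.zero_f]
    simp [hg, reassoc_of% this]

end Cone

/-! ### Two-term complexes: discs and stalks -/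

section Double

open HomologicalComplex

variable {A : Type u} [Category.{v} A] [Abelian A]

theorem down_rel (n : ℤ) : (ComplexShape.down ℤ).Rel n (n - 1) := by simp

/-- The chain complex with `f : X ⟶ Y` in degrees `n` and `n - 1`. -/
noncomputable abbrev chainDouble {X Y : A} (f : X ⟶ Y) (n : ℤ) : ChainComplex A ℤ :=
  double f (down_rel n)

theorem ne_sub_one (n : ℤ) : n ≠ n - 1 := by omega

/-- The morphism of complexes `chainDouble` given by a commutative square. -/
noncomputable def chainDoubleMap {X Y X' Y' : A} {f : X ⟶ Y} {f' : X' ⟶ Y'} (a : X ⟶ X')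
    (b : Y ⟶ Y') (h : a ≫ f' = f ≫ b) (n : ℤ) : chainDouble f n ⟶ chainDouble f' n :=
  mkHomFromDouble (down_rel n) (ne_sub_one n) (a ≫ (doubleXIso₀ f' (down_rel n)).inv)
    (b ≫ (doubleXIso₁ f' (down_rel n) (ne_sub_one n)).inv)
    (by simp [double_d f' (down_rel n) (ne_sub_one n), reassoc_of% h])
    (by
      intro k hk
      rw [double_d_eq_zero₀ _ _ _ _ (ne_sub_one n).symm, comp_zero])

@[simp]
theorem chainDoubleMap_f₀ {X Y X' Y' : A} {f : X ⟶ Y} {f' : X' ⟶ Y'} (a : X ⟶ X')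
    (b : Y ⟶ Y') (h : a ≫ f' = f ≫ b) (n : ℤ) : (chainDoubleMap a b h n).f n =
      (doubleXIso₀ f (down_rel n)).hom ≫ a ≫ (doubleXIso₀ f' (down_rel n)).inv :=
  mkHomFromDouble_f₀ _ _ _ _ _ _

@[simp]
theorem chainDoubleMap_f₁ {X Y X' Y' : A} {f : X ⟶ Y} {f' : X' ⟶ Y'} (a : X ⟶ X')
    (b : Y ⟶ Y') (h : a ≫ f' = f ≫ b) (n : ℤ) : (chainDoubleMap a b h n).f (n - 1) =
      (doubleXIso₁ f (down_rel n) (ne_sub_one n)).hom ≫ b ≫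
        (doubleXIso₁ f' (down_rel n) (ne_sub_one n)).inv :=
  mkHomFromDouble_f₁ _ _ _ _ _ _

/-- A morphism `f` of short complexes gives a short complex of the complexes `chainDouble`. -/
noncomputable def chainDoubleShortComplex {S S' : ShortComplex A} (f : S ⟶ S') (n : ℤ) :
    ShortComplex (ChainComplex A ℤ) where
  X₁ := chainDouble f.τ₁ n
  X₂ := chainDouble f.τ₂ n
  X₃ := chainDouble f.τ₃ n
  f := chainDoubleMap S.f S'.f f.comm₁₂.symm n
  g := chainDoubleMap S.g S'.g f.comm₂₃.symm n
  zero := by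
    apply from_double_hom_ext <;> simp [chainDoubleMap]

theorem chainDoubleShortComplex_shortExact {S S' : ShortComplex A} (f : S ⟶ S')
    (hS : S.ShortExact) (hS' : S'.ShortExact) (n : ℤ) :
    (chainDoubleShortComplex f n).ShortExact := by
  apply shortExact_of_degreewise_shortExact
  intro q
  by_cases h₀ : q = n
  · subst h₀
    refine ShortComplex.shortExact_of_iso (ShortComplex.isoMk (doubleXIso₀ f.τ₁ (down_rel q)).symm
      (doubleXIso₀ f.τ₂ (down_rel q)).symm (doubleXIso₀ f.τ₃ (down_rel q)).symm ?_ ?_) hS <;>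
    · simp only [chainDoubleShortComplex, chainDoubleMap, Iso.symm_hom, ShortComplex.map_f,
        ShortComplex.map_g, HomologicalComplex.eval_map, mkHomFromDouble_f₀]
      exact Iso.inv_hom_id_assoc _ _
  · by_cases h₁ : q = n - 1
    · subst h₁
      refine ShortComplex.shortExact_of_iso (ShortComplex.isoMk
        (doubleXIso₁ f.τ₁ (down_rel n) (ne_sub_one n)).symm
        (doubleXIso₁ f.τ₂ (down_rel n) (ne_sub_one n)).symm
        (doubleXIso₁ f.τ₃ (down_rel n) (ne_sub_one n)).symm ?_ ?_) hS' <;>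
      · simp only [chainDoubleShortComplex, chainDoubleMap, Iso.symm_hom, ShortComplex.map_f,
          ShortComplex.map_g, HomologicalComplex.eval_map, mkHomFromDouble_f₁]
        exact Iso.inv_hom_id_assoc _ _
    · have z : ∀ {X Y : A} (f : X ⟶ Y), IsZero ((chainDouble f n).X q) := fun f =>
        isZero_double_X f (down_rel n) q h₀ h₁
      exact { exact := ShortComplex.exact_of_isZero_X₂ _ (z f.τ₂)
              mono_f := ⟨fun _ _ _ => (z f.τ₁).eq_of_tgt _ _⟩
              epi_g := ⟨fun _ _ _ => (z f.τ₃).eq_of_src _ _⟩ }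

theorem degreewise_chainDouble {F : ObjectProperty A} (hF : ∀ X, IsZero X → F X)
    (hF' : ∀ X Y : A, (X ≅ Y) → F X → F Y) {X Y : A} (f : X ⟶ Y) (n : ℤ) (hX : F X) (hY : F Y) :
    degreewise F (chainDouble f n) := by
  intro q
  by_cases h₀ : q = n
  · subst h₀
    exact hF' _ _ (doubleXIso₀ f (down_rel q)).symm hX
  · by_cases h₁ : q = n - 1
    · subst h₁
      exact hF' _ _ (doubleXIso₁ f (down_rel n) (ne_sub_one n)).symm hY
    · exact hF _ (isZero_double_X f (down_rel n) q h₀ h₁)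

/-- A map to `chainDouble f n` given by its components. -/
theorem exists_hom_to_chainDouble {X Y : A} (f : X ⟶ Y) (n : ℤ) (K : ChainComplex A ℤ)
    (a : K.X n ⟶ X) (b : K.X (n - 1) ⟶ Y) (h : K.d n (n - 1) ≫ b = a ≫ f)
    (h' : K.d (n + 1) n ≫ a = 0) : ∃ φ : K ⟶ chainDouble f n,
      φ.f n ≫ (doubleXIso₀ f (down_rel n)).hom = a ∧
      φ.f (n - 1) ≫ (doubleXIso₁ f (down_rel n) (ne_sub_one n)).hom = b := by
  let c : ∀ q, K.X q ⟶ (chainDouble f n).X q := fun q =>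
    if hq : q = n then (K.XIsoOfEq hq).hom ≫ a ≫ (doubleXIso₀ f (down_rel n)).inv ≫
      ((chainDouble f n).XIsoOfEq hq).inv
    else if hq : q = n - 1 then (K.XIsoOfEq hq).hom ≫ b ≫
      (doubleXIso₁ f (down_rel n) (ne_sub_one n)).inv ≫ ((chainDouble f n).XIsoOfEq hq).inv
    else 0
  have c₀ : c n = a ≫ (doubleXIso₀ f (down_rel n)).inv := by simp [c]
  have c₁ : c (n - 1) = b ≫ (doubleXIso₁ f (down_rel n) (ne_sub_one n)).inv := by simp [c]
  refine ⟨{ f := c, comm' := ?_ }, by simp [c₀], by simp [c₁]⟩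
  rintro i j (hij : j + 1 = i)
  by_cases h₁ : j = n - 1
  · obtain rfl : i = n := by omega
    subst h₁
    simp [c₀, c₁, double_d f (down_rel i) (ne_sub_one i), reassoc_of% h]
  · rw [double_d_eq_zero₁ _ _ _ _ h₁, comp_zero]
    by_cases h₀ : j = n
    · subst h₀ hij
      rw [c₀, reassoc_of% h', zero_comp]
    · exact (isZero_double_X f (down_rel n) j h₀ h₁).eq_of_tgt _ _

theorem cohoExact_chainDouble_id (X Y : A) (n : ℤ) : CohoExact (chainDouble (𝟙 X) n) Y := by
  intro q f hf
  by_cases h₀ : q = n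
  · subst h₀
    have := double_d (𝟙 X) (down_rel q) (ne_sub_one q)
    refine ⟨(doubleXIso₁ (𝟙 X) (down_rel q) (ne_sub_one q)).hom ≫
      (doubleXIso₀ (𝟙 X) (down_rel q)).inv ≫ f, ?_⟩
    rw [this]
    simp
  · by_cases h₁ : q = n - 1
    · subst h₁
      refine ⟨0, ?_⟩
      rw [show n - 1 + 1 = n by omega, double_d (𝟙 X) (down_rel n) (ne_sub_one n)] at hf
      have hf' : ((doubleXIso₀ (𝟙 X) (down_rel n)).hom ≫
          (doubleXIso₁ (𝟙 X) (down_rel n) (ne_sub_one n)).inv) ≫ f = 0 := by simpa using hf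
      rw [comp_zero]
      exact ((cancel_epi _).1 (hf'.trans comp_zero.symm)).symm
    · exact ⟨0, (isZero_double_X (𝟙 X) (down_rel n) q h₀ h₁).eq_of_src _ _⟩

end Double

/-! ### The cotorsion theory determined by Hom-exactness -/

section Abstract

open HomologicalComplex ZeroObject

variable {A : Type u} [Category.{v} A] [Abelian A]

/-- Chain maps from K to the disc on Y are the same as maps K_{n-1} ⟶ Y, so only orthogonality in
degree n - 1 is needed. -/
theorem rightPerp_chainDouble_id {F : ObjectProperty A} {t : ObjectProperty (ChainComplex A ℤ)}
    (ht : t ≤ degreewise F) {Y : A} (hY : rightPerp F Y) (n : ℤ) :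
    rightPerp t (chainDouble (𝟙 Y) n) := by
  intro S hS hK φ
  obtain ⟨(b : S.X₂.X (n - 1) ⟶ Y), hb⟩ := hY _ ((shortExact_iff_degreewise_shortExact S).1 hS (n - 1))
    (ht _ hK (n - 1)) (φ.f (n - 1) ≫ (doubleXIso₁ (𝟙 Y) (down_rel n) (ne_sub_one n)).hom)
  replace hb : S.f.f (n - 1) ≫ b = φ.f (n - 1) ≫
    (doubleXIso₁ (𝟙 Y) (down_rel n) (ne_sub_one n)).hom := hb
  obtain ⟨ψ, hψ₀, hψ₁⟩ := exists_hom_to_chainDouble (𝟙 Y) n S.X₂ (S.X₂.d n (n - 1) ≫ b) b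
    (by simp) (by simp)
  refine ⟨ψ, ?_⟩
  apply to_double_hom_ext
  · rw [← cancel_mono (doubleXIso₀ (𝟙 Y) (down_rel n)).hom]
    simp only [HomologicalComplex.comp_f, Category.assoc, hψ₀]
    rw [S.f.comm_assoc, hb, ← φ.comm_assoc, double_d (𝟙 Y) (down_rel n) (ne_sub_one n)]
    simp
  · rw [← cancel_mono (doubleXIso₁ (𝟙 Y) (down_rel n) (ne_sub_one n)).hom]
    simp only [HomologicalComplex.comp_f, Category.assoc, hψ₁, hb]

/-- Chain maps from the disc on X to D are the same as maps X ⟶ D_n, so D is tested on discs of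
short exact sequences. -/
theorem degreewise_of_rightPerp {F : ObjectProperty A} {t : ObjectProperty (ChainComplex A ℤ)}
    (h : ∀ X n, F X → t (chainDouble (𝟙 X) n)) {D : ChainComplex A ℤ} (hD : rightPerp t D) :
    degreewise (rightPerp F) D := by
  intro n S hS hX g
  obtain ⟨(l : chainDouble (𝟙 S.X₂) n ⟶ D), hl⟩ := hD _ (chainDoubleShortComplex_shortExact (𝟙 S) hS hS n) (h _ n hX)
    (mkHomFromDouble (down_rel n) (ne_sub_one n) g (g ≫ D.d n (n - 1)) (by simp) (by simp))
  have : (chainDoubleMap S.f S.f (f := 𝟙 _) (f' := 𝟙 _) (by simp) n).f n ≫ l.f n = _ :=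
    congrArg (fun φ => φ.f n) hl
  refine ⟨(doubleXIso₀ (𝟙 S.X₂) (down_rel n)).inv ≫ l.f n, ?_⟩
  simp only [chainDoubleMap_f₀, mkHomFromDouble_f₀, Category.assoc] at this
  exact (cancel_epi (doubleXIso₀ (𝟙 S.X₁) (down_rel n)).hom).1 this

theorem degreewise_of_leftPerp {F : ObjectProperty A} {t : ObjectProperty (ChainComplex A ℤ)}
    (hF : leftPerp (rightPerp F) ≤ F) (ht : t ≤ degreewise F) {K : ChainComplex A ℤ}
    (hK : leftPerp (rightPerp t) K) : degreewise F K := by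
  intro m
  -- A map into a disc is determined by its component in the lower degree n - 1.
  obtain ⟨n, rfl⟩ : ∃ n, m = n - 1 := ⟨m + 1, by omega⟩
  apply hF
  intro S hS hY g
  obtain ⟨φ, -, hφ⟩ := exists_hom_to_chainDouble (𝟙 S.X₃) n K (K.d n (n - 1) ≫ g) g
    (by simp) (by simp)
  obtain ⟨(l : K ⟶ chainDouble (𝟙 S.X₂) n), hl⟩ := hK _ (chainDoubleShortComplex_shortExact (𝟙 S) hS hS n)
    (rightPerp_chainDouble_id ht hY n) φ
  have : l.f (n - 1) ≫ (chainDoubleMap S.g S.g (f := 𝟙 _) (f' := 𝟙 _) (by simp) n).f (n - 1) = _ :=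
    congrArg (fun φ => φ.f (n - 1)) hl
  refine ⟨l.f (n - 1) ≫ (doubleXIso₁ (𝟙 S.X₂) (down_rel n) (ne_sub_one n)).hom, ?_⟩
  rw [← hφ, ← this]
  simp

theorem chainDouble_zero_d (X Y : A) (n i j : ℤ) : (chainDouble (0 : X ⟶ Y) n).d i j = 0 := by
  by_cases hi : i = n
  · subst hi
    by_cases hj : j = i - 1
    · subst hj
      rw [double_d _ (down_rel i) (ne_sub_one i), zero_comp, comp_zero]
    · exact double_d_eq_zero₁ _ _ _ _ hj
  · exact double_d_eq_zero₀ _ _ _ _ hi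

/-- As Z is zero, this complex is the stalk of Y in degree n - 1; its zero differential reduces
homotopy orthogonality to exactness of Hom(K, Y). -/
theorem rightPerp_chainDouble_zero {F : ObjectProperty A}
    {t : ObjectProperty (ChainComplex A ℤ)} (ht : t ≤ degreewise F) {Y : A} (hY : rightPerp F Y)
    (hY' : ∀ K, t K → CohoExact K Y) {Z : A} (hZ : IsZero Z) (n : ℤ) :
    rightPerp t (chainDouble (0 : Z ⟶ Y) n) := by
  refine rightPerp_of_degreewise_of_rightHPerp ht (degreewise_chainDouble
    (fun _ => rightPerp_of_isZero F) (fun _ _ => rightPerp_of_iso F) _ _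
    (rightPerp_of_isZero F hZ) hY) fun K hK => ?_
  exact homgr_acyclic_of_cohoExact (chainDouble_zero_d Z Y n)
    (degreewise_chainDouble (F := fun Y => CohoExact K Y) (fun _ => cohoExact_of_isZero K)
      (fun _ _ => CohoExact.of_iso) (0 : Z ⟶ Y) n (cohoExact_of_isZero K hZ) (hY' K hK))

/-- Maps from K to the stalk of Y in degree n are the maps K_n ⟶ Y vanishing on boundaries; those
that lift to the disc are the ones of the form d ≫ g. -/
theorem cohoExact_of_forall_lift {K : ChainComplex A ℤ} {Y : A}
    (h : ∀ n, Function.Surjective (fun φ : K ⟶ chainDouble (𝟙 Y) n =>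
      φ ≫ chainDoubleMap (𝟙 Y) (0 : Y ⟶ 0) (f' := 0) (by simp) n)) :
    CohoExact K Y := by
  intro n f hf
  obtain ⟨φ, hφ, -⟩ := exists_hom_to_chainDouble (0 : Y ⟶ 0) n K f 0 (by simp) hf
  obtain ⟨l, hl⟩ := h n φ
  have := congrArg (fun φ => φ.f n) hl
  refine ⟨l.f (n - 1) ≫ (doubleXIso₁ (𝟙 Y) (down_rel n) (ne_sub_one n)).hom, ?_⟩
  simp only [HomologicalComplex.comp_f, chainDoubleMap_f₀] at this
  rw [← hφ, ← this, ← l.comm_assoc, double_d (𝟙 Y) (down_rel n) (ne_sub_one n)]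
  simp

/-- The kernel of the projection from the disc on Y to its degree n stalk is the stalk in degree n -
1, which lies in t^⊥. -/
theorem cohoExact_of_leftPerp {F : ObjectProperty A} {t : ObjectProperty (ChainComplex A ℤ)}
    (ht : t ≤ degreewise F) {Y : A} (hY : rightPerp F Y) (hY' : ∀ K, t K → CohoExact K Y)
    {K : ChainComplex A ℤ} (hK : leftPerp (rightPerp t) K) : CohoExact K Y := by
  apply cohoExact_of_forall_lift
  intro n
  let S : ShortComplex A := ShortComplex.mk (0 : 0 ⟶ Y) (𝟙 Y) (by simp)
  let S' : ShortComplex A := ShortComplex.mk (𝟙 Y) (0 : Y ⟶ 0) (by simp)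
  have hS : S.ShortExact :=
    { exact := (S.exact_iff_mono rfl).2 (inferInstanceAs (Mono (𝟙 Y)))
      mono_f := ⟨fun _ _ _ => (isZero_zero A).eq_of_tgt _ _⟩
      epi_g := inferInstanceAs (Epi (𝟙 Y)) }
  have hS' : S'.ShortExact :=
    { exact := (S'.exact_iff_epi rfl).2 (inferInstanceAs (Epi (𝟙 Y)))
      mono_f := inferInstanceAs (Mono (𝟙 Y))
      epi_g := ⟨fun _ _ _ => (isZero_zero A).eq_of_src _ _⟩ }
  exact hK _ (chainDoubleShortComplex_shortExact
    (⟨0, 𝟙 Y, 0, by simp [S, S'], by simp [S, S']⟩ : S ⟶ S') hS hS' n)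
    (rightPerp_chainDouble_zero ht hY hY' (isZero_zero A) n)

/-- A chain map is a cycle of degree 0, and a cochain bounding it involves only the differential of
K. -/
theorem exists_fac_of_homgr_acyclic {K D : ChainComplex A ℤ} (h : (Homgr K D).Acyclic)
    (hd : ∀ i j, D.d i j = 0) (φ : K ⟶ D) (q : ℤ) :
    ∃ s : K.X (q - 1) ⟶ D.X q, K.d q (q - 1) ≫ s = φ.f q := by
  have hφ : ∀ i j, K.d i j ≫ φ.f j = 0 := fun i j => by rw [← φ.comm, hd, comp_zero]
  obtain ⟨s, hs⟩ := (homgr_acyclic_iff K D).1 h 0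
    (fun t => φ.f t.1.1 ≫ (D.XIsoOfEq (by have := t.2; omega)).hom) (by
      funext ⟨⟨p, q⟩, hpq⟩
      simp [gradedHomD, GradedHom.comp, hd, reassoc_of% hφ])
  have := congrFun hs ⟨(q, q), by simp⟩
  simp only [gradedHomD, AddMonoidHom.coe_mk, ZeroHom.coe_mk, hd, comp_zero, zero_sub] at this
  exact ⟨s.comp (q - 1) q (by omega), by simpa using this⟩

theorem cohoExact_of_homgr_acyclic {K : ChainComplex A ℤ} {Y Z : A}
    (h : ∀ n, (Homgr K (chainDouble (0 : Z ⟶ Y) n)).Acyclic) : CohoExact K Y := by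
  intro m f hf
  obtain ⟨n, rfl⟩ : ∃ n, m = n - 1 := ⟨m + 1, by omega⟩
  rw [sub_add_cancel] at hf
  obtain ⟨φ, -, hφ⟩ := exists_hom_to_chainDouble (0 : Z ⟶ Y) n K 0 f (by simpa using hf) (by simp)
  obtain ⟨s, hs⟩ := exists_fac_of_homgr_acyclic (h n) (chainDouble_zero_d Z Y n) φ (n - 1)
  exact ⟨s ≫ (doubleXIso₁ (0 : Z ⟶ Y) (down_rel n) (ne_sub_one n)).hom, by
    rw [reassoc_of% hs, hφ]⟩

/-- The cotorsion theory cogenerated by stalk complexes on a class `𝒴₀`. -/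
theorem isCotorsionTheory_of_cohoExact {F 𝒴₀ : ObjectProperty A}
    (hF : leftPerp (rightPerp F) ≤ F) (h𝒴 : 𝒴₀ ≤ rightPerp F)
    {t : ObjectProperty (ChainComplex A ℤ)}
    (ht : ∀ K, t K ↔ degreewise F K ∧ ∀ Y, 𝒴₀ Y → CohoExact K Y) :
    IsCotorsionTheory t (rightPerp t) ∧
    t = degreewise F ⊓ leftHPerp (rightPerp t) ∧
    rightPerp t = degreewise (rightPerp F) ⊓ rightHPerp t := by
  have hF' : leftPerp (rightPerp F) = F := le_antisymm hF (le_leftPerp_rightPerp F)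
  have hle : t ≤ degreewise F := fun K hK => ((ht K).1 hK).1
  have htw : ∀ K m, t K → t (twist K m) := fun K m hK =>
    (ht _).2 ⟨fun q => ((ht _).1 hK).1 (q - m), fun Y hY => (((ht _).1 hK).2 Y hY).twist m⟩
  have hdisc : ∀ X n, F X → t (chainDouble (𝟙 X) n) := fun X n hX =>
    (ht _).2 ⟨degreewise_chainDouble (fun X hX => hF X (leftPerp_of_isZero _ hX))
      (fun X Y e hX => hF Y (leftPerp_of_iso _ e (le_leftPerp_rightPerp F X hX))) _ _ hX hX,
      fun Y _ => cohoExact_chainDouble_id X Y n⟩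
  have hleft : leftPerp (rightPerp t) ≤ t := fun K hK =>
    (ht K).2 ⟨degreewise_of_leftPerp hF hle hK, fun Y hY =>
      cohoExact_of_leftPerp hle (h𝒴 Y hY) (fun K hK => ((ht K).1 hK).2 Y hY) hK⟩
  have hacyc : ∀ K D, t K → rightPerp t D → (Homgr K D).Acyclic := fun K D hK hD =>
    homgr_acyclic_of_rightPerp hD fun m => htw K m hK
  refine ⟨⟨le_antisymm (le_leftPerp_rightPerp t) hleft, rfl⟩, le_antisymm ?_ ?_,
    le_antisymm ?_ ?_⟩
  · exact fun K hK => ⟨hle K hK, fun D hD => hacyc K D hK hD⟩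
  · rintro K ⟨hK, hK'⟩
    refine (ht K).2 ⟨hK, fun Y hY => cohoExact_of_homgr_acyclic fun n =>
      hK' _ (rightPerp_chainDouble_zero hle (h𝒴 Y hY) (fun K hK => ((ht K).1 hK).2 Y hY)
        (isZero_zero A) n)⟩
  · exact fun D hD => ⟨degreewise_of_rightPerp hdisc hD, fun K hK => hacyc K D hK hD⟩
  · exact fun D hD => rightPerp_of_degreewise_of_rightHPerp hle hD.1 hD.2

end Abstract

/-! ### Detecting exactness of a complex by Hom into test objects -/

section AcyclicCriteria

variable {A : Type u} [Category.{v} A] [Abelian A]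

/-- Q is the cokernel of the incoming differential; exactness becomes injectivity of the map it
induces. -/
theorem exists_opcycles_fac (K : ChainComplex A ℤ) (n : ℤ) :
    ∃ (Q : A) (q : K.X n ⟶ Q) (m : Q ⟶ K.X (n - 1)), Epi q ∧ K.d (n + 1) n ≫ q = 0 ∧
      q ≫ m = K.d n (n - 1) ∧
      (∀ ⦃Y : A⦄ (f : K.X n ⟶ Y), K.d (n + 1) n ≫ f = 0 → ∃ f' : Q ⟶ Y, q ≫ f' = f) ∧
      (K.ExactAt n ↔ Mono m) := by
  let S := K.sc' (n + 1) n (n - 1)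
  refine ⟨S.opcycles, S.pOpcycles, S.fromOpcycles,
    inferInstanceAs (Epi S.pOpcycles), S.f_pOpcycles,
    S.p_fromOpcycles, fun Y f hf => ⟨S.descOpcycles f hf, S.p_descOpcycles f hf⟩, ?_⟩
  rw [HomologicalComplex.exactAt_iff' _ (n + 1) n (n - 1) (by simp) (by simp),
    ShortComplex.exact_iff_mono_fromOpcycles]
  rfl

/-- An embedding of Q into a test object extends along `m`, which forces `m` to be a monomorphism.
-/
theorem acyclic_of_cohoExact {𝒴 : ObjectProperty A} (h𝒴 : EnoughRight 𝒴) {K : ChainComplex A ℤ}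
    (hK : ∀ Y, 𝒴 Y → CohoExact K Y) : K.Acyclic := by
  intro n
  obtain ⟨Q, q, m, _, hq, hqm, -, hiff⟩ := exists_opcycles_fac K n
  rw [hiff]
  obtain ⟨Y, i, hY, hi⟩ := h𝒴 Q
  obtain ⟨g, hg⟩ := hK Y hY n (q ≫ i) (by rw [reassoc_of% hq, zero_comp])
  have : m ≫ g = i := by
    rw [← cancel_epi q, reassoc_of% hqm, hg]
  exact mono_of_mono_fac this

theorem acyclic_iff_cohoExact_injective [EnoughInjectives A] (K : ChainComplex A ℤ) :
    K.Acyclic ↔ ∀ I, Injective I → CohoExact K I := by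
  refine ⟨fun hK I _ n f hf => ?_, fun hK => acyclic_of_cohoExact (𝒴 := fun I => Injective I)
    (fun X => ⟨_, Injective.ι X, inferInstance, inferInstance⟩) hK⟩
  have := (HomologicalComplex.exactAt_iff' _ (n + 1) n (n - 1) (by simp) (by simp)).1 (hK n)
  exact ⟨this.descToInjective f hf, this.comp_descToInjective f hf⟩

/-- Pushing 0 → Q → K_{n-1} → K_{n-2} out along Q ⟶ Y gives an exact sequence 0 → Y → P → K_{n-2}. A
retraction of Y ⟶ P then extends f. -/
theorem cohoExact_of_underlineRight {F 𝒴 : ObjectProperty A} {Y : A} (hY : underlineRight F 𝒴 Y)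
    {K : ChainComplex A ℤ} (hK : K.Acyclic) (hK' : degreewise F K) : CohoExact K Y := by
  intro n f hf
  have hS' := (HomologicalComplex.exactAt_iff' _ n (n - 1) (n - 1 - 1)
    (by simp) (by simp)).1 (hK (n - 1))
  obtain ⟨Q, q, m, _, -, hpm, hdesc, hiff⟩ := exists_opcycles_fac K n
  have hm : Mono m := hiff.1 (hK n)
  obtain ⟨f', hpf⟩ := hdesc f hf
  have hmd : m ≫ K.d (n - 1) (n - 1 - 1) = 0 := by
    rw [← cancel_epi q, reassoc_of% hpm, K.d_comp_d, comp_zero]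
  let p : pushout m f' ⟶ K.X (n - 1 - 1) := pushout.desc (K.d (n - 1) (n - 1 - 1)) 0
    (by rw [hmd, comp_zero])
  have hp₁ : pushout.inl m f' ≫ p = K.d (n - 1) (n - 1 - 1) := pushout.inl_desc _ _ _
  have hp₂ : pushout.inr m f' ≫ p = 0 := pushout.inr_desc _ _ _
  -- If inl a + inr y is killed by `p`, then d a = 0, so a = d z = m (q z), and the pushout relation
  -- moves inl a into the image of Y.
  have hex : (ShortComplex.mk (pushout.inr m f') p hp₂).Exact := by
    rw [ShortComplex.exact_iff_exact_up_to_refinements]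
    intro W (x : W ⟶ pushout m f') (hx : x ≫ p = 0)
    have hepi : Epi (biprod.desc (pushout.inl m f') (pushout.inr m f')) := ⟨fun g h e =>
      pushout.hom_ext (by simpa using congrArg (fun k => biprod.inl ≫ k) e)
        (by simpa using congrArg (fun k => biprod.inr ≫ k) e)⟩
    obtain ⟨W₁, π₁, _, y, hy⟩ := surjective_up_to_refinements_of_epi
      (biprod.desc (pushout.inl m f') (pushout.inr m f')) x
    have hy₀ : (y ≫ biprod.fst) ≫ K.d (n - 1) (n - 1 - 1) = 0 := by
      have := congrArg (fun k => k ≫ p) hy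
      simp only [Category.assoc, hx, comp_zero] at this
      rw [this, Category.assoc]
      congr 1
      apply biprod.hom_ext' <;> simp [hp₁, hp₂]
    obtain ⟨W₂, π₂, _, (z : W₂ ⟶ K.X n), hz⟩ := hS'.exact_up_to_refinements (y ≫ biprod.fst) hy₀
    replace hz : π₂ ≫ y ≫ biprod.fst = z ≫ K.d n (n - 1) := hz
    refine ⟨W₂, π₂ ≫ π₁, epi_comp _ _, z ≫ f + π₂ ≫ y ≫ biprod.snd, ?_⟩
    change (π₂ ≫ π₁) ≫ x = _ ≫ pushout.inr m f'
    rw [Category.assoc, hy, biprod.desc_eq, Preadditive.comp_add, Preadditive.comp_add,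
      reassoc_of% hz, ← hpm, Category.assoc, pushout.condition, Preadditive.add_comp,
      Category.assoc, reassoc_of% hpf]
    simp
  obtain ⟨r, hr⟩ := hY.2 _ p hp₂ inferInstance hex (hK' _)
  refine ⟨pushout.inl m f' ≫ r, ?_⟩
  rw [← hpm, Category.assoc, pushout.condition_assoc, hr, Category.comp_id, hpf]

end AcyclicCriteria

/-! ### Flatness and tensoring with a stalk -/

section Tensor

variable {A₁ : Type u₁} {A₂ : Type u₂} {A₃ : Type u₃}
  [Category.{v₁} A₁] [Category.{v₂} A₂] [Category.{v₃} A₃]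
  [Abelian A₁] [Abelian A₂] [Abelian A₃]

/-- A substitute for Tor₁(Z, `S.X₃`) = 0: a chase in T(N, S), T(P, S), T(Z, S), where P is a flat
cover of Z with kernel N. -/
theorem mono_map_of_flat (T : A₁ ⥤ A₂ ⥤ A₃)
    [T.Additive] [∀ X : A₁, (T.obj X).Additive]
    [∀ X, PreservesFiniteColimits (T.obj X)] [∀ X, PreservesFiniteColimits (T.flip.obj X)]
    (enoughFlat₁ : EnoughLeft (flatLeft T)) (Z : A₁) {S : ShortComplex A₂} (hS : S.ShortExact)
    (hY : flatRight T S.X₃) : Mono ((T.obj Z).map S.f) := by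
  obtain ⟨P, p, hP, hp⟩ := enoughFlat₁ Z
  have : (T.obj P).PreservesMonomorphisms := hP
  have : (T.flip.obj S.X₃).PreservesMonomorphisms := hY
  have := hS.mono_f
  have := hS.epi_g
  have hm : Mono ((T.obj P).map S.f) := inferInstance
  have hm' : Mono ((T.map (kernel.ι p)).app S.X₃) :=
    inferInstanceAs (Mono ((T.flip.obj S.X₃).map (kernel.ι p)))
  let R : ShortComplex A₁ := ShortComplex.mk (kernel.ι p) p (kernel.condition p)
  have hR : R.Exact := ShortComplex.exact_kernel p
  have hepi : ∀ X, Epi ((T.map p).app X) := fun X =>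
    inferInstanceAs (Epi ((T.flip.obj X).map p))
  have : Epi R.g := hp
  have hcol : ∀ X, (R.map (T.flip.obj X)).Exact := fun X =>
    hR.map_of_epi_of_preservesCokernel (T.flip.obj X) inferInstance inferInstance
  have hrow : ∀ X, (S.map (T.obj X)).Exact := fun X =>
    hS.exact.map_of_epi_of_preservesCokernel (T.obj X) inferInstance inferInstance
  refine Preadditive.mono_of_cancel_zero _ fun {W} a ha => ?_
  obtain ⟨W₁, π₁, _, a', ha'⟩ := surjective_up_to_refinements_of_epi ((T.map p).app S.X₁) a
  obtain ⟨W₂, π₂, _, (k : W₂ ⟶ (T.obj (kernel p)).obj S.X₂), hk⟩ := (hcol S.X₂).exact_up_to_refinements (a' ≫ (T.obj P).map S.f) (by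
    change (a' ≫ _) ≫ (T.map p).app S.X₂ = 0
    rw [Category.assoc, NatTrans.naturality, ← reassoc_of% ha', ha, comp_zero])
  replace hk : π₂ ≫ a' ≫ (T.obj P).map S.f = k ≫ (T.map (kernel.ι p)).app S.X₂ := hk
  -- Flatness of `S.X₃` makes T(N, `S.X₃`) ⟶ T(P, `S.X₃`) injective, so k comes from T(N, `S.X₁`).
  have hk₀ : k ≫ (T.obj (kernel p)).map S.g = 0 := by
    rw [← cancel_mono ((T.map (kernel.ι p)).app S.X₃), Category.assoc, NatTrans.naturality,
      ← reassoc_of% hk, ← Functor.map_comp, S.zero, Functor.map_zero, comp_zero, comp_zero,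
      zero_comp]
  obtain ⟨W₃, π₃, _, (l : W₃ ⟶ (T.obj (kernel p)).obj S.X₁), hl⟩ := (hrow (kernel p)).exact_up_to_refinements k hk₀
  replace hl : π₃ ≫ k = l ≫ (T.obj (kernel p)).map S.f := hl
  have hl' : π₃ ≫ π₂ ≫ a' = l ≫ (T.map (kernel.ι p)).app S.X₁ := by
    rw [← cancel_mono ((T.obj P).map S.f), Category.assoc, Category.assoc, hk, reassoc_of% hl,
      Category.assoc, NatTrans.naturality]
  have h0 : (T.map (kernel.ι p)).app S.X₁ ≫ (T.map p).app S.X₁ = 0 := by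
    rw [← NatTrans.comp_app, ← Functor.map_comp, kernel.condition, Functor.map_zero]
    rfl
  rw [← cancel_epi π₁, ← cancel_epi π₂, ← cancel_epi π₃, ha', reassoc_of% hl', h0]
  simp

variable [HasColimits A₃]

open HomologicalComplex in
-- Only the summands of bidegree (0, n) are nonzero, and there the Koszul sign is 1. It suffices
-- that the inclusions `j` commute with differentials and induce bijections on maps into I.
theorem tensorComplex_single_cohoExact_iff (T : A₁ ⥤ A₂ ⥤ A₃)
    [T.Additive] [∀ X : A₁, (T.obj X).Additive] (E : A₁) (K : ChainComplex A₂ ℤ) (I : A₃) :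
    CohoExact (tensorComplex T ((single A₁ (ComplexShape.down ℤ) 0).obj E) K) I ↔
      CohoExact (((T.obj E).mapHomologicalComplex _).obj K) I := by
  let L := (single A₁ (ComplexShape.down ℤ) 0).obj E
  let e : L.X 0 ≅ E := singleObjXSelf (ComplexShape.down ℤ) 0 E
  let j : ∀ n, (T.obj E).obj (K.X n) ⟶ (tensorComplex T L K).X n := fun n =>
    (T.map e.inv).app (K.X n) ≫ ιMapBifunctor L K T (ComplexShape.down ℤ) 0 n n (zero_add n)
  have hj : ∀ n m, m + 1 = n → j n ≫ (tensorComplex T L K).d n m =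
      (T.obj E).map (K.d n m) ≫ j m := by
    intro n m h
    have h₁ : mapBifunctor.d₁ L K T (ComplexShape.down ℤ) 0 n m = 0 := by
      rw [mapBifunctor.d₁_eq' _ _ _ _ (show (ComplexShape.down ℤ).Rel 0 (-1) by simp),
        single_obj_d, Functor.map_zero]
      simp
    have h₂ : mapBifunctor.d₂ L K T (ComplexShape.down ℤ) 0 n m =
        (T.obj (L.X 0)).map (K.d n m) ≫
          ιMapBifunctor L K T (ComplexShape.down ℤ) 0 m m (zero_add m) := by
      rw [mapBifunctor.d₂_eq _ _ _ _ 0 (show (ComplexShape.down ℤ).Rel n m from h) m (zero_add m)]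
      have : ComplexShape.ε₂ (ComplexShape.down ℤ) (ComplexShape.down ℤ) (ComplexShape.down ℤ)
        (0, n) = 1 := Int.negOnePow_zero
      rw [this, one_smul]
    simp only [j, Category.assoc, mapBifunctor.d_eq, Preadditive.comp_add,
      mapBifunctor.ι_D₁, mapBifunctor.ι_D₂, h₁, h₂, zero_add, comp_zero]
    rw [NatTrans.naturality_assoc]
  have hbij : ∀ n (f : (T.obj E).obj (K.X n) ⟶ I),
      ∃ g : (tensorComplex T L K).X n ⟶ I, j n ≫ g = f := by
    intro n f
    refine ⟨mapBifunctorDesc (fun i₁ i₂ h => if h₁ : i₁ = 0 then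
      (T.map ((L.XIsoOfEq h₁).hom ≫ e.hom)).app (K.X i₂) ≫
        (T.obj E).map (K.XIsoOfEq (by subst h₁; exact (zero_add i₂).symm.trans h)).hom ≫ f
      else 0), ?_⟩
    simp only [j, Category.assoc, ι_mapBifunctorDesc]
    simp [← NatTrans.comp_app_assoc, ← Functor.map_comp]
  have hinj : ∀ n (f g : (tensorComplex T L K).X n ⟶ I), j n ≫ f = j n ≫ g → f = g := by
    intro n f g h
    apply mapBifunctor.hom_ext
    intro i₁ i₂ h'
    by_cases h₁ : i₁ = 0
    · subst h₁
      obtain rfl : i₂ = n := (zero_add i₂).symm.trans h'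
      simp only [j, Category.assoc] at h
      exact (cancel_epi ((T.map e.inv).app (K.X i₂))).1 h
    · have z : IsZero (L.X i₁) := isZero_single_obj_X _ _ _ _ h₁
      exact ((T.flip.obj (K.X i₂)).map_isZero z).eq_of_src _ _
  constructor
  · intro h n (f : (T.obj E).obj (K.X n) ⟶ I) hf
    replace hf : (T.obj E).map (K.d (n + 1) n) ≫ f = 0 := hf
    obtain ⟨f', rfl⟩ := hbij n f
    obtain ⟨g, hg⟩ := h n f' (hinj _ _ _ (by
      rw [← Category.assoc, hj _ _ rfl, Category.assoc, hf, comp_zero]))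
    refine ⟨j (n - 1) ≫ g, ?_⟩
    change (T.obj E).map (K.d n (n - 1)) ≫ (j (n - 1) ≫ g : (T.obj E).obj (K.X (n - 1)) ⟶ I) =
      (_ : (T.obj E).obj (K.X n) ⟶ I)
    rw [← Category.assoc, ← hj _ _ (by omega), Category.assoc, hg]
  · intro h n f hf
    obtain ⟨(g : (T.obj E).obj (K.X (n - 1)) ⟶ I), hg⟩ := h n (j n ≫ f) (by
      change (T.obj E).map (K.d (n + 1) n) ≫ (j n ≫ f : (T.obj E).obj (K.X n) ⟶ I) =
        (0 : (T.obj E).obj (K.X (n + 1)) ⟶ I)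
      rw [← Category.assoc, ← hj _ _ rfl, Category.assoc, hf, comp_zero])
    replace hg : (T.obj E).map (K.d n (n - 1)) ≫ g = j n ≫ f := hg
    obtain ⟨g', rfl⟩ := hbij (n - 1) g
    refine ⟨g', hinj _ _ _ ?_⟩
    rw [← Category.assoc, hj _ _ (by omega), Category.assoc, hg]

end Tensor

/-! ### Transporting Hom-exactness across an adjunction -/

section Adjunction

variable {A : Type u₁} {B : Type u₂} [Category.{v₁} A] [Category.{v₂} B]
  [Abelian A] [Abelian B]

theorem cohoExact_map_iff_of_adjunction {F : A ⥤ B} {G : B ⥤ A} (adj : F ⊣ G) [F.Additive]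
    (K : ChainComplex A ℤ) (I : B) :
    CohoExact ((F.mapHomologicalComplex _).obj K) I ↔ CohoExact K (G.obj I) := by
  have key : ∀ {X Y : A} (d : X ⟶ Y) (f : F.obj Y ⟶ I) (f' : F.obj X ⟶ I),
      F.map d ≫ f = f' ↔ d ≫ adj.homEquiv _ _ f = adj.homEquiv _ _ f' := by
    intro X Y d f f'
    rw [← adj.homEquiv_naturality_left]
    exact (adj.homEquiv _ _).injective.eq_iff.symm
  have hz : ∀ X : A, adj.homEquiv X I 0 = 0 := by
    intro X
    rw [adj.homEquiv_unit]
    have := adj.right_adjoint_additive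
    simp
  have key₀ : ∀ {X Y : A} (d : X ⟶ Y) (f : F.obj Y ⟶ I),
      F.map d ≫ f = 0 ↔ d ≫ adj.homEquiv _ _ f = 0 := by
    intro X Y d f
    rw [key, hz]
  constructor
  · intro h n f hf
    obtain ⟨f, rfl⟩ := (adj.homEquiv _ _).surjective f
    obtain ⟨g, hg⟩ := h n f ((key₀ _ _).2 hf)
    exact ⟨adj.homEquiv _ _ g, (key _ _ _).1 hg⟩
  · intro h n f hf
    obtain ⟨g, hg⟩ := h n (adj.homEquiv _ _ f) ((key₀ _ _).1 hf)
    obtain ⟨g, rfl⟩ := (adj.homEquiv _ _).surjective g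
    exact ⟨g, (key _ _ _).2 hg⟩

end Adjunction

/-! ### Flat objects and the functors C(-, I) -/

section FlatCotorsion

open Opposite

variable {A₁ : Type u₁} {A₂ : Type u₂} {A₃ : Type u₃}
  [Category.{v₁} A₁] [Category.{v₂} A₂] [Category.{v₃} A₃]
  [Abelian A₂] [Abelian A₃]
  {T : A₁ ⥤ A₂ ⥤ A₃} {C : A₁ᵒᵖ ⥤ A₃ ⥤ A₂} [∀ X : A₁, (T.obj X).Additive]

theorem homEquiv_eq_zero_iff (adjC : T ⊣₂ C) {Z : A₁} {X : A₂} {I : A₃}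
    (f : (T.obj Z).obj X ⟶ I) : adjC.homEquiv f = 0 ↔ f = 0 := by
  have := (adjC.adj Z).right_adjoint_additive
  have h0 : adjC.homEquiv (0 : (T.obj Z).obj X ⟶ I) = 0 := by
    rw [ParametrizedAdjunction.homEquiv_eq, Adjunction.homEquiv_unit]
    simp
  rw [← h0, adjC.homEquiv.injective.eq_iff]

variable [Abelian A₁] [T.Additive]

/-- Additivity of C in its first variable is not assumed; the vanishing is transposed from T. -/
theorem map_comp_map_eq_zero (adjC : T ⊣₂ C) {S : ShortComplex A₁} (I : A₃) :
    (C.map S.g.op).app I ≫ (C.map S.f.op).app I = 0 := by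
  obtain ⟨h, hh⟩ := adjC.homEquiv.surjective ((C.map S.g.op).app I)
  have h₁ : adjC.homEquiv.symm (𝟙 _ ≫ (C.map S.g.op).app I) = h := by
    rw [Category.id_comp, ← hh, Equiv.symm_apply_apply]
  rw [adjC.homEquiv_symm_naturality_one] at h₁
  rw [← hh, ← adjC.homEquiv_naturality_one, homEquiv_eq_zero_iff, ← h₁, ← Category.assoc,
    ← NatTrans.comp_app, ← Functor.map_comp, S.zero, Functor.map_zero]
  simp

theorem tex_iff [HasColimits A₃] [EnoughInjectives A₃] (adjC : T ⊣₂ C)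
    (enoughUnderline₂ : EnoughRight (underlineRight (flatRight T) (rightPerp (flatRight T))))
    (K : ChainComplex A₂ ℤ) :
    tex T K ↔ degreewise (flatRight T) K ∧
      ∀ Y, (underlineRight (flatRight T) (rightPerp (flatRight T)) Y ∨
        ∃ (E : A₁) (I : A₃), Injective E ∧ Injective I ∧ Y = (C.obj (op E)).obj I) →
        CohoExact K Y := by
  have hT : ∀ E : A₁, (tensorComplex T
      ((HomologicalComplex.single A₁ (ComplexShape.down ℤ) 0).obj E) K).Acyclic ↔
        ∀ I : A₃, Injective I → CohoExact K ((C.obj (op E)).obj I) := fun E => by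
    rw [acyclic_iff_cohoExact_injective]
    simp only [tensorComplex_single_cohoExact_iff, cohoExact_map_iff_of_adjunction (adjC.adj E)]
  constructor
  · rintro ⟨h, hex, hK⟩
    refine ⟨hK, ?_⟩
    rintro Y (hY | ⟨E, I, hE, hI, rfl⟩)
    · exact cohoExact_of_underlineRight hY hex hK
    · exact (hT E).1 (h E hE) I hI
  · rintro ⟨hK, h⟩
    exact ⟨fun E hE => (hT E).2 fun I hI => h _ (Or.inr ⟨E, I, hE, hI, rfl⟩),
      acyclic_of_cohoExact enoughUnderline₂ fun Y hY => h Y (Or.inl hY), hK⟩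

variable [∀ X, PreservesFiniteColimits (T.flip.obj X)]

/-- For `I` injective, `C(-, I)` sends short exact sequences to short exact sequences. -/
theorem shortExact_map (adjC : T ⊣₂ C) (enoughFlat₂ : EnoughLeft (flatRight T))
    {S : ShortComplex A₁} (hS : S.ShortExact) (I : A₃) [Injective I] :
    (ShortComplex.mk _ _ (map_comp_map_eq_zero adjC (S := S) I)).ShortExact := by
  have := hS.epi_g
  have := hS.mono_f
  have hepi : ∀ X, Epi ((T.map S.g).app X) := fun X =>
    inferInstanceAs (Epi ((T.flip.obj X).map S.g))
  have hmono : Mono ((C.map S.g.op).app I) := by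
    refine Preadditive.mono_of_cancel_zero _ fun {W} a ha => ?_
    obtain ⟨b, rfl⟩ := adjC.homEquiv.surjective a
    rw [← adjC.homEquiv_naturality_one, homEquiv_eq_zero_iff] at ha
    rw [homEquiv_eq_zero_iff, ← cancel_epi ((T.map S.g).app W), ha, comp_zero]
  refine { exact := ?_, mono_f := hmono, epi_g := ?_ }
  · refine ShortComplex.exact_of_f_is_kernel _ (KernelFork.IsLimit.ofι' _ _ fun {W} k hk => ?_)
    have hrow : (S.map (T.flip.obj W)).Exact :=
      hS.exact.map_of_epi_of_preservesCokernel (T.flip.obj W) inferInstance inferInstance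
    have : Epi (S.map (T.flip.obj W)).g := hepi W
    have hk₁ : (S.map (T.flip.obj W)).f ≫ adjC.homEquiv.symm k = 0 := by
      change (T.map S.f).app W ≫ _ = 0
      rw [← homEquiv_eq_zero_iff adjC, adjC.homEquiv_naturality_one, Equiv.apply_symm_apply]
      exact hk
    have key : ∃ m : (T.obj S.X₃).obj W ⟶ I,
        (T.map S.g).app W ≫ m = adjC.homEquiv.symm k := ⟨hrow.desc _ hk₁, hrow.g_desc _ hk₁⟩
    refine ⟨adjC.homEquiv key.choose, ?_⟩
    change _ ≫ (C.map S.g.op).app I = k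
    rw [← adjC.homEquiv_naturality_one, key.choose_spec, Equiv.apply_symm_apply]
  -- For surjectivity it is enough to lift a flat cover p of the target: its transpose T(`S.X₁`, P)
  -- ⟶ I extends along the monomorphism T(`S.f`, P).
  · obtain ⟨P, p, hP, hp⟩ := enoughFlat₂ ((C.obj (op S.X₁)).obj I)
    have : (T.flip.obj P).PreservesMonomorphisms := hP
    have : Mono ((T.map S.f).app P) := inferInstanceAs (Mono ((T.flip.obj P).map S.f))
    have h : adjC.homEquiv (Injective.factorThru (adjC.homEquiv.symm p) ((T.map S.f).app P)) ≫
        (C.map S.f.op).app I = p := by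
      rw [← adjC.homEquiv_naturality_one, Injective.comp_factorThru, Equiv.apply_symm_apply]
    exact epi_of_epi_fac h

variable [∀ X, PreservesFiniteColimits (T.obj X)]

theorem rightPerp_flat_of_injective (adjC : T ⊣₂ C) (enoughFlat₁ : EnoughLeft (flatLeft T))
    (Z : A₁) (I : A₃) [Injective I] : rightPerp (flatRight T) ((C.obj (op Z)).obj I) := by
  intro S hS hY g
  have := mono_map_of_flat T enoughFlat₁ Z hS hY
  refine ⟨adjC.homEquiv (Injective.factorThru (adjC.homEquiv.symm g) ((T.obj Z).map S.f)), ?_⟩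
  dsimp only
  rw [← adjC.homEquiv_naturality_two, Injective.comp_factorThru, Equiv.apply_symm_apply]

/-- Embed T(Z, X) in an injective I. The transpose X ⟶ C(Z, I) lifts to C(Z', I), since the kernel
C(coker f, I) lies in ℱ^⊥; transposing back, the embedding factors through T(f, X). -/
theorem leftPerp_rightPerp_flat_le [EnoughInjectives A₃] (adjC : T ⊣₂ C)
    (enoughFlat₁ : EnoughLeft (flatLeft T)) (enoughFlat₂ : EnoughLeft (flatRight T)) :
    leftPerp (rightPerp (flatRight T)) ≤ flatRight T := by
  intro X hX
  refine ⟨fun {Z Z'} f _ => ?_⟩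
  change Mono ((T.map f).app X)
  let S : ShortComplex A₁ := ShortComplex.mk f (cokernel.π f) (cokernel.condition f)
  have hS : S.ShortExact :=
    { exact := ShortComplex.exact_cokernel f
      mono_f := inferInstanceAs (Mono f)
      epi_g := inferInstanceAs (Epi (cokernel.π f)) }
  let I := Injective.under ((T.obj Z).obj X)
  obtain ⟨l, hl⟩ := hX _ (shortExact_map adjC enoughFlat₂ hS I)
    (rightPerp_flat_of_injective adjC enoughFlat₁ _ I) (adjC.homEquiv (Injective.ι _))
  replace hl : l ≫ (C.map f.op).app I = adjC.homEquiv (Injective.ι _) := hl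
  have h : (T.map f).app X ≫ adjC.homEquiv.symm l = Injective.ι _ := by
    apply adjC.homEquiv.injective
    rw [adjC.homEquiv_naturality_one, Equiv.apply_symm_apply, hl]
  exact mono_of_mono_fac h

end FlatCotorsion

end CotorsionTHC

/-! ### The cotorsion theory of totally acyclic complexes -/

theorem mainTheorem6
    {A₁ : Type u₁} {A₂ : Type u₂} {A₃ : Type u₃}
    [Category.{v₁} A₁] [Category.{v₂} A₂] [Category.{v₃} A₃]
    [Abelian A₁] [Abelian A₂] [Abelian A₃]
    [HasLimits A₁] [HasLimits A₂] [HasColimits A₃]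
    (T : A₁ ⥤ A₂ ⥤ A₃) (H : A₂ᵒᵖ ⥤ A₃ ⥤ A₁) (C : A₁ᵒᵖ ⥤ A₃ ⥤ A₂)
    [T.Additive] [∀ X : A₁, (T.obj X).Additive]
    (adjH : T.flip ⊣₂ H) (adjC : T ⊣₂ C)
    (enoughFlat₁ : CotorsionTHC.EnoughLeft (CotorsionTHC.flatLeft T))
    (enoughFlat₂ : CotorsionTHC.EnoughLeft (CotorsionTHC.flatRight T))
    (enoughInj₃ : EnoughInjectives A₃)
    (enoughUnderline₂ : CotorsionTHC.EnoughRight (CotorsionTHC.underlineRight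
      (CotorsionTHC.flatRight T) (CotorsionTHC.rightPerp (CotorsionTHC.flatRight T)))) :
    CotorsionTHC.IsCotorsionTheory
      (CotorsionTHC.tex T) (CotorsionTHC.rightPerp (CotorsionTHC.tex T)) ∧
    CotorsionTHC.tex T =
      CotorsionTHC.degreewise (CotorsionTHC.flatRight T) ⊓
        CotorsionTHC.leftHPerp (CotorsionTHC.rightPerp (CotorsionTHC.tex T)) ∧
    CotorsionTHC.rightPerp (CotorsionTHC.tex T) =
      CotorsionTHC.degreewise (CotorsionTHC.rightPerp (CotorsionTHC.flatRight T)) ⊓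
        CotorsionTHC.rightHPerp (CotorsionTHC.tex T) := by
  -- Being a left adjoint in each variable, T is right exact in each; H serves only for this.
  have := fun X => (adjC.adj X).leftAdjoint_preservesColimits
  have := fun X => (adjH.adj X).leftAdjoint_preservesColimits
  have : ∀ X, PreservesFiniteColimits (T.obj X) := fun X => inferInstance
  have : ∀ X, PreservesFiniteColimits (T.flip.obj X) := fun X => inferInstance
  refine CotorsionTHC.isCotorsionTheory_of_cohoExact
    (CotorsionTHC.leftPerp_rightPerp_flat_le adjC enoughFlat₁ enoughFlat₂) ?_
    (CotorsionTHC.tex_iff adjC enoughUnderline₂)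
  rintro Y (hY | ⟨E, I, hE, hI, rfl⟩)
  · exact hY.1
  · exact CotorsionTHC.rightPerp_flat_of_injective adjC enoughFlat₁ E I
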